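/- Let $n>1$ be an odd integer and consider the one-dimensional majority rule model with blocks of size $n$. Configurations are functions $\eta:\mathbb Z\to\{0,1\}$, identified with the subsets $\{x:\eta(x)=1\}$ of $\mathbb Z$; the hyperedges are the blocks $h_x=\{x,x+1,\dots,x+n-1\}$, $x\in\mathbb Z$; and the dynamics is given by the Markov generator, acting on functions $f$ that depend on finitely many vertices, $$Lf(\eta)=\sum_{x\in\mathbb Z}\mathbf 1\{\operatorname{card}(\eta\cap h_x)<n/2\}\,[f(\eta\setminus h_x)-f(\eta)]+\sum_{x\in\mathbb Z}\mathbf 1\{\operatorname{card}(\eta\cap h_x)\ge n/2\}\,[f(\eta\cup h_x)-f(\eta)],$$ that is, at rate one all vertices of each block simultaneously adopt the majority opinion of the block. Here a process $(\eta_t)_{t\ge0}$ with generator $L$ started from $\eta_0$ is an adapted process with right-continuous paths with left limits in $\{0,1\}^{\mathbb Z}$ (product topology), with almost sure initial configuration $\eta_0$, such that $f(\eta_t)-\int_0^t Lf(\eta_s)\,ds$ is a martingale for every function $f$ that depends on finitely many vertices. Then the process clusters: starting from any configuration $\eta_0$, $$P(\eta_t(x)\ne\eta_t(y))\to0\quad\text{as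 }t\to\infty,\qquad\text{for all }x,y\in\mathbb Z.$$ -/

import Mathlib

open MeasureTheory ProbabilityTheory Filter Topology
open scoped NNReal

namespace MajorityRule

/-- A spatial configuration: `η x = true` means that vertex `x` has opinion 1, and
`η x = false` means that it has opinion 0. -/
abbrev Config (V : Type*) : Type _ := V → Bool

variable {V : Type*} [DecidableEq V]

/-- The number of vertices with opinion 1 in the hyperedge `h`, i.e. `card (η ∩ h)`. -/
def numOnes (h : Finset V) (η : Config V) : ℕ :=
  (h.filter fun v => η v = true).card

/-- The configuration obtained from `η` by giving opinion `b` to every vertex of `h`: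
it is `η ∪ h` when `b = true` and `η \ h` when `b = false`. -/
def setOpinion (h : Finset V) (b : Bool) (η : Config V) : Config V :=
  fun v => if v ∈ h then b else η v

/-- The Markov generator of the majority rule model on the hypergraph whose hyperedges are the
`h i`: at rate one, all the vertices of `h i` become 0 if `card (η ∩ h i) < card (h i) / 2`, and
all become 1 if `card (η ∩ h i) ≥ card (h i) / 2`.
If `f` depends on finitely many vertices and each vertex is in finitely many hyperedges, then only
finitely many terms of the sum are nonzero. -/
noncomputable def generator {ι : Type*} (h : ι → Finset V) (f : Config V → ℝ) (η : Config V) : ℝ :=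
  ∑' i, if (numOnes (h i) η : ℝ) < ((h i).card : ℝ) / 2
    then f (setOpinion (h i) false η) - f η
    else f (setOpinion (h i) true η) - f η

/-- The hyperedge `h_x = x + {0, 1, …, n - 1}` of the one-dimensional lattice. -/
noncomputable def block (n : ℕ) (x : ℤ) : Finset ℤ := Finset.Ico x (x + n)

/-- `f` is a local (cylinder) function: it depends on the opinions of finitely many vertices. -/
def IsLocal (f : Config V → ℝ) : Prop :=
  ∃ A : Finset V, DependsOn f (A : Set V)

/-- The process `η` is a realization on `(Ω, P)`, with respect to the filtration `ℱ`, of the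
one-dimensional majority rule model with blocks of size `n` starting from `η₀`: it is an
adapted càdlàg process that solves the martingale problem for the generator of the model on
local functions. (Opinions carry the discrete topology, configurations the product topology.) -/
structure IsMajorityRuleProcess {Ω : Type*} {mΩ : MeasurableSpace Ω} (n : ℕ) (η₀ : Config ℤ)
    (P : Measure Ω) (ℱ : Filtration ℝ≥0 mΩ) (η : ℝ≥0 → Ω → Config ℤ) : Prop where
  init : ∀ᵐ ω ∂P, η 0 ω = η₀
  adapted : ∀ t, Measurable[ℱ t] (η t)
  right_continuous : ∀ ω t, ContinuousWithinAt (fun s => η s ω) (Set.Ici t) t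
  left_limits : ∀ ω t, ∃ ζ : Config ℤ, Tendsto (fun s => η s ω) (𝓝[<] t) (𝓝 ζ)
  martingale : ∀ f : Config ℤ → ℝ, IsLocal f →
    Martingale
      (fun t ω => f (η t ω) - ∫ s in (0 : ℝ)..t, generator (block n) f (η s.toNNReal ω)) ℱ P

/-- Clustering: any two vertices eventually share the same opinion, in probability. -/
def Clusters {Ω : Type*} {mΩ : MeasurableSpace Ω} (P : Measure Ω) (η : ℝ≥0 → Ω → Config V) :
    Prop :=
  ∀ x y : V, Tendsto (fun t => P {ω | η t ω x ≠ η t ω y}) atTop (𝓝 0)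

end MajorityRule

/-!
The proof uses only the forward equation `d/dt E f(η_t) = E (L f)(η_t)` for local functions `f`; no
graphical construction, uniqueness or Markov property is needed. Write `n = 2 * m + 1`, say that
there is a wall at `e` if the vertices `e` and `e + 1` disagree, and let `v_t(e)` be the probability
of a wall at `e` at time `t`.

Walls are dominated by independent random walks. A wall at `e` disappears when one of the `2 * m`
blocks containing both `e` and `e + 1` is updated. A wall can appear at `e` only through the block
starting at `e + 1` or the block ending at `e`, and only if the end vertex of that block next to
`e` is in the minority, which forces a wall within distance `m` of `e` inside the block
(`gainLeftEnd_le`, `gainRightEnd_le`). Hence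
`L (wall e) = ∑_{0 < |j| ≤ m} (wall (e + j) - wall e) - deficit e` with `deficit e ≥ 0`, so that `v`
is a subsolution of a discrete heat equation.

Nearby walls cause a deficit. Given walls at `a` and `a + d`, either there is a deficit at `a + 1`,
or the update of a single block moves the first wall to `a + 1`; two adjacent walls do cause a
deficit (`wallPair_succ_sub_deficit_le`, `wallPair_one_le_deficit`).

Now let `c` be an upper bound of `v` from some time on, and suppose that `v_t(e)` is within `δ` of
`c` for some late `t`. The gap `c - v ≥ 0` is a supersolution with source the expected deficit, so
the elementary comparison `le_exp_mul_of_deriv_ge` bounds the gaps and the expected deficits at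
earlier times near `e` by multiples of `δ` (`gap_le_pow_mul`, `mean_deficit_le_gap`), and then also
the probability of two walls in a window of `D` sites near `e` (`mean_wallPair_le`). Such a window
carries `D * c - O(δ)` walls in expectation but at most `1 + O(δ)`, so `D * c ≤ 1 + O(δ)`, where the
implied constant depends on `m` and `D` only (`mul_le_one_add_of_gap_le`). Therefore an eventual
bound `c ≥ ε > 1 / D` can be lowered by a fixed amount, again and again, until it is at most `ε`
(`eventually_mean_wall_le`). Thus `v_t → 0` uniformly in space, which is clustering.
-/

namespace MajorityRule

/-! ### Block updates and the generator as a finite sum -/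

/-- The opinion that the vertices of the block at `x` adopt when that block is updated. -/
noncomputable def majority (n : ℕ) (x : ℤ) (η : Config ℤ) : Bool :=
  !decide ((numOnes (block n x) η : ℝ) < ((block n x).card : ℝ) / 2)

/-- The configuration after the update of the block at `x`. -/
noncomputable def update (n : ℕ) (x : ℤ) (η : Config ℤ) : Config ℤ :=
  setOpinion (block n x) (majority n x η) η

lemma mem_block {n : ℕ} {x y : ℤ} : y ∈ block n x ↔ x ≤ y ∧ y < x + n := by
  simp [block]

lemma update_of_mem {n : ℕ} {x y : ℤ} (η : Config ℤ) (h₁ : x ≤ y) (h₂ : y < x + n) :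
    update n x η y = majority n x η := by
  simp [update, setOpinion, mem_block, h₁, h₂]

lemma update_of_lt {n : ℕ} {x y : ℤ} (η : Config ℤ) (h : y < x) : update n x η y = η y := by
  simp [update, setOpinion, mem_block, not_le.mpr h]

lemma update_of_ge {n : ℕ} {x y : ℤ} (η : Config ℤ) (h : x + n ≤ y) : update n x η y = η y := by
  simp [update, setOpinion, mem_block, not_lt.mpr h]

lemma generator_eq_tsum (n : ℕ) (f : Config ℤ → ℝ) (η : Config ℤ) :
    generator (block n) f η = ∑' x, (f (update n x η) - f η) := by
  unfold generator update majority
  congr 1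
  ext x
  split_ifs with h <;> simp [h]

lemma update_eqOn {n : ℕ} {x a b : ℤ} (η : Config ℤ) (hx : x ∉ Finset.Icc (a - n + 1) b) :
    ∀ y ∈ Set.Icc a b, update n x η y = η y := by
  intro y hy
  rw [Set.mem_Icc] at hy
  rw [Finset.mem_Icc, not_and_or] at hx
  rcases hx with hx | hx
  · exact update_of_ge η (by omega)
  · exact update_of_lt η (by omega)

lemma generator_eq_sum {n : ℕ} {f : Config ℤ → ℝ} {a b a' : ℤ}
    (hf : DependsOn f (Set.Icc a b)) (ha : a' ≤ a - n + 1) (η : Config ℤ) :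
    generator (block n) f η = ∑ x ∈ Finset.Icc a' b, (f (update n x η) - f η) := by
  rw [generator_eq_tsum]
  refine tsum_eq_sum fun x hx => ?_
  rw [hf (x := update n x η) (y := η), sub_self]
  refine update_eqOn η fun h => hx ?_
  rw [Finset.mem_Icc] at h ⊢
  omega

/-- If at least `m + 1` of the `2 * m + 1` vertices of a block agree, theirs is the majority
opinion. -/
lemma majority_eq_of_card {m : ℕ} {x : ℤ} {η : Config ℤ} {b : Bool} {s : Finset ℤ}
    (hs : s ⊆ block (2 * m + 1) x) (hcard : m + 1 ≤ s.card) (hb : ∀ y ∈ s, η y = b) :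
    majority (2 * m + 1) x η = b := by
  have hc : (block (2 * m + 1) x).card = 2 * m + 1 := by
    rw [block, Int.card_Ico]
    omega
  have hsum := Finset.card_filter_add_card_filter_not (s := block (2 * m + 1) x)
    (fun v => η v = true)
  have hnum : numOnes (block (2 * m + 1) x) η
      = ((block (2 * m + 1) x).filter fun v => η v = true).card := rfl
  cases b with
  | true =>
    have h : s.card ≤ numOnes (block (2 * m + 1) x) η :=
      Finset.card_le_card fun y hy => Finset.mem_filter.2 ⟨hs hy, hb y hy⟩
    have h' : ¬ ((numOnes (block (2 * m + 1) x) η : ℝ)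
        < ((block (2 * m + 1) x).card : ℝ) / 2) := by
      rw [hc, not_lt]
      have : ((m + 1 : ℕ) : ℝ) ≤ numOnes (block (2 * m + 1) x) η := by
        exact_mod_cast hcard.trans h
      push_cast at this ⊢
      linarith
    simp [majority, h']
  | false =>
    have h : s.card ≤ ((block (2 * m + 1) x).filter fun v => ¬ η v = true).card :=
      Finset.card_le_card fun y hy => Finset.mem_filter.2 ⟨hs hy, by simp [hb y hy]⟩
    have h' : (numOnes (block (2 * m + 1) x) η : ℝ)
        < ((block (2 * m + 1) x).card : ℝ) / 2 := by
      have : numOnes (block (2 * m + 1) x) η ≤ m := by omega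
      have : (numOnes (block (2 * m + 1) x) η : ℝ) ≤ m := by exact_mod_cast this
      rw [hc]
      push_cast
      linarith
    simp only [majority, h', decide_true, Bool.not_true]

/-! ### Walls between unequal neighbours -/

/-- The indicator that there is a wall at `e`, that is, that the neighbouring vertices `e` and
`e + 1` have different opinions. -/
noncomputable def wall (e : ℤ) (η : Config ℤ) : ℝ := if η e ≠ η (e + 1) then 1 else 0

lemma wall_nonneg (e : ℤ) (η : Config ℤ) : 0 ≤ wall e η := by
  unfold wall; split_ifs <;> norm_num

lemma wall_le_one (e : ℤ) (η : Config ℤ) : wall e η ≤ 1 := by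
  unfold wall; split_ifs <;> norm_num

lemma wall_eq_zero_or_one (e : ℤ) (η : Config ℤ) : wall e η = 0 ∨ wall e η = 1 := by
  unfold wall; split_ifs <;> simp

lemma wall_eq_zero_iff {e : ℤ} {η : Config ℤ} : wall e η = 0 ↔ η e = η (e + 1) := by
  unfold wall; split_ifs with h <;> simp_all

lemma dependsOn_wall {e a b : ℤ} (ha : a ≤ e) (hb : e + 1 ≤ b) :
    DependsOn (wall e) (Set.Icc a b) := by
  intro η ζ h
  unfold wall
  rw [h e ⟨ha, by omega⟩, h (e + 1) ⟨by omega, hb⟩]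

/-- The change of the wall indicator at `e` when the block that starts at `e + 1` is updated. -/
noncomputable def gainLeftEnd (n : ℕ) (e : ℤ) (η : Config ℤ) : ℝ :=
  (if η e ≠ majority n (e + 1) η then 1 else 0) - wall e η

/-- The change of the wall indicator at `e` when the block that ends at `e` is updated. -/
noncomputable def gainRightEnd (n : ℕ) (e : ℤ) (η : Config ℤ) : ℝ :=
  (if majority n (e - n + 1) η ≠ η (e + 1) then 1 else 0) - wall e η

lemma wall_update_left {n : ℕ} (hn : 1 ≤ n) (e : ℤ) (η : Config ℤ) :
    wall e (update n (e + 1) η) = if η e ≠ majority n (e + 1) η then 1 else 0 := by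
  unfold wall
  rw [update_of_lt η (by omega), update_of_mem η le_rfl (by omega)]

lemma wall_update_right {n : ℕ} (hn : 1 ≤ n) (e : ℤ) (η : Config ℤ) :
    wall e (update n (e - n + 1) η)
      = if majority n (e - n + 1) η ≠ η (e + 1) then 1 else 0 := by
  unfold wall
  rw [update_of_ge (y := e + 1) η (by omega), update_of_mem η (by omega) (by omega)]

lemma wall_update_inside {n : ℕ} {x e : ℤ} (h₁ : x ≤ e) (h₂ : e + 1 < x + n) (η : Config ℤ) :
    wall e (update n x η) = 0 := by
  rw [wall_eq_zero_iff, update_of_mem η h₁ (by omega), update_of_mem η (by omega) h₂]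

lemma generator_wall {m : ℕ} (e : ℤ) (η : Config ℤ) :
    generator (block (2 * m + 1)) (wall e) η
      = gainLeftEnd (2 * m + 1) e η + gainRightEnd (2 * m + 1) e η - 2 * m * wall e η := by
  rw [generator_eq_sum (dependsOn_wall le_rfl le_rfl) le_rfl]
  have h₁ : Finset.Icc (e - (2 * m + 1 : ℕ) + 1) (e + 1)
      = insert (e + 1) (insert (e - (2 * m + 1 : ℕ) + 1)
        (Finset.Icc (e - (2 * m + 1 : ℕ) + 2) e)) := by
    ext y; simp only [Finset.mem_insert, Finset.mem_Icc]; omega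
  rw [h₁, Finset.sum_insert, Finset.sum_insert, wall_update_left (by omega),
    wall_update_right (by omega), Finset.sum_congr rfl (g := fun _ => - wall e η)]
  · rw [Finset.sum_const, Int.card_Icc]
    have h₂ : (e + 1 - (e - (2 * m + 1 : ℕ) + 2)).toNat = 2 * m := by omega
    rw [h₂, nsmul_eq_mul]
    unfold gainLeftEnd gainRightEnd
    push_cast
    ring
  · intro x hx
    rw [Finset.mem_Icc] at hx
    rw [wall_update_inside (by omega) (by omega), zero_sub]
  · simp only [Finset.mem_Icc]; omega
  · simp only [Finset.mem_insert, Finset.mem_Icc]; omega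

/-- A wall is created at the left end of a block only if the first vertex of the block is in the
minority; then the first `m + 1` vertices of the block do not all agree. -/
lemma gainLeftEnd_le (m : ℕ) (e : ℤ) (η : Config ℤ) :
    gainLeftEnd (2 * m + 1) e η ≤ ∑ j ∈ Finset.range m, wall (e + 1 + j) η := by
  by_cases h : ∃ j ∈ Finset.range m, wall (e + 1 + j) η = 1
  · obtain ⟨j, hj, hj1⟩ := h
    have h₁ := Finset.single_le_sum (f := fun j : ℕ => wall (e + 1 + j) η)
      (fun i _ => wall_nonneg _ _) hj
    have h₂ : gainLeftEnd (2 * m + 1) e η ≤ 1 := by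
      unfold gainLeftEnd
      have := wall_nonneg e η
      split_ifs <;> linarith
    simp only [hj1] at h₁
    linarith
  · push Not at h
    have hconst : ∀ j : ℕ, j ≤ m → η (e + 1 + j) = η (e + 1) := by
      intro j
      induction j with
      | zero => simp
      | succ j ih =>
        intro hj
        have h0 := (wall_eq_zero_or_one (e + 1 + j) η).resolve_right
          (h j (Finset.mem_range.2 (by omega)))
        rw [wall_eq_zero_iff] at h0
        rw [← ih (by omega), h0]
        push_cast
        ring_nf
    have hmaj : majority (2 * m + 1) (e + 1) η = η (e + 1) := by
      refine majority_eq_of_card (s := Finset.Ico (e + 1) (e + 1 + (m + 1 : ℕ))) ?_ (by simp) ?_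
      · intro y hy
        rw [Finset.mem_Ico] at hy
        rw [mem_block]
        omega
      · intro y hy
        rw [Finset.mem_Ico] at hy
        have := hconst (y - (e + 1)).toNat (by omega)
        rwa [show e + 1 + ((y - (e + 1)).toNat : ℤ) = y by omega] at this
    have : gainLeftEnd (2 * m + 1) e η = 0 := by
      unfold gainLeftEnd wall
      rw [hmaj, sub_self]
    rw [this]
    exact Finset.sum_nonneg fun _ _ => wall_nonneg _ _

lemma gainRightEnd_le (m : ℕ) (e : ℤ) (η : Config ℤ) :
    gainRightEnd (2 * m + 1) e η ≤ ∑ j ∈ Finset.range m, wall (e - 1 - j) η := by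
  by_cases h : ∃ j ∈ Finset.range m, wall (e - 1 - j) η = 1
  · obtain ⟨j, hj, hj1⟩ := h
    have h₁ := Finset.single_le_sum (f := fun j : ℕ => wall (e - 1 - j) η)
      (fun i _ => wall_nonneg _ _) hj
    have h₂ : gainRightEnd (2 * m + 1) e η ≤ 1 := by
      unfold gainRightEnd
      have := wall_nonneg e η
      split_ifs <;> linarith
    simp only [hj1] at h₁
    linarith
  · push Not at h
    have hconst : ∀ j : ℕ, j ≤ m → η (e - j) = η e := by
      intro j
      induction j with
      | zero => simp
      | succ j ih =>
        intro hj
        have h0 := (wall_eq_zero_or_one (e - 1 - j) η).resolve_right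
          (h j (Finset.mem_range.2 (by omega)))
        rw [wall_eq_zero_iff] at h0
        rw [← ih (by omega), show e - (j : ℤ) = e - 1 - j + 1 by ring, ← h0]
        push_cast
        ring_nf
    have hmaj : majority (2 * m + 1) (e - (2 * m + 1 : ℕ) + 1) η = η e := by
      refine majority_eq_of_card (s := Finset.Ico (e - m) (e + 1)) ?_ ?_ ?_
      · intro y hy
        rw [Finset.mem_Ico] at hy
        rw [mem_block]
        omega
      · rw [Int.card_Ico]
        omega
      · intro y hy
        rw [Finset.mem_Ico] at hy
        have := hconst (e - y).toNat (by omega)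
        rwa [show e - ((e - y).toNat : ℤ) = y by omega] at this
    have : gainRightEnd (2 * m + 1) e η = 0 := by
      unfold gainRightEnd wall
      rw [hmaj, sub_self]
    rw [this]
    exact Finset.sum_nonneg fun _ _ => wall_nonneg _ _

/-- The amount by which the drift of the wall indicator at `e` falls short of that of a system of
independent walls, each jumping at rate one to every site within distance `m`. -/
noncomputable def deficit (m : ℕ) (e : ℤ) (η : Config ℤ) : ℝ :=
  ∑ j ∈ Finset.range m, wall (e + 1 + j) η + ∑ j ∈ Finset.range m, wall (e - 1 - j) η
    - gainLeftEnd (2 * m + 1) e η - gainRightEnd (2 * m + 1) e η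

lemma deficit_nonneg (m : ℕ) (e : ℤ) (η : Config ℤ) : 0 ≤ deficit m e η := by
  have h₁ := gainLeftEnd_le m e η
  have h₂ := gainRightEnd_le m e η
  unfold deficit
  linarith

lemma generator_wall_eq_sub_deficit (m : ℕ) (e : ℤ) (η : Config ℤ) :
    generator (block (2 * m + 1)) (wall e) η
      = ∑ j ∈ Finset.range m, wall (e + 1 + j) η + ∑ j ∈ Finset.range m, wall (e - 1 - j) η
        - 2 * m * wall e η - deficit m e η := by
  rw [generator_wall]
  unfold deficit
  ring

lemma majority_congr {n : ℕ} {x : ℤ} {η ζ : Config ℤ}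
    (h : ∀ y, x ≤ y → y < x + n → η y = ζ y) : majority n x η = majority n x ζ := by
  have : numOnes (block n x) η = numOnes (block n x) ζ := by
    unfold numOnes
    congr 1
    refine Finset.filter_congr fun y hy => ?_
    rw [mem_block] at hy
    rw [h y hy.1 hy.2]
  unfold majority
  rw [this]

lemma dependsOn_deficit {m : ℕ} {e a b : ℤ} (ha : a ≤ e - (2 * m + 1)) (hb : e + (2 * m + 1) ≤ b) :
    DependsOn (deficit m e) (Set.Icc a b) := by
  intro η ζ h
  have hw : ∀ y, a ≤ y → y + 1 ≤ b → wall y η = wall y ζ := fun y h₁ h₂ =>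
    dependsOn_wall h₁ h₂ h
  have h₁ : ∑ j ∈ Finset.range m, wall (e + 1 + j) η = ∑ j ∈ Finset.range m, wall (e + 1 + j) ζ :=
    Finset.sum_congr rfl fun j hj => by
      rw [Finset.mem_range] at hj; exact hw _ (by omega) (by omega)
  have h₂ : ∑ j ∈ Finset.range m, wall (e - 1 - j) η = ∑ j ∈ Finset.range m, wall (e - 1 - j) ζ :=
    Finset.sum_congr rfl fun j hj => by
      rw [Finset.mem_range] at hj; exact hw _ (by omega) (by omega)
  have h₃ : majority (2 * m + 1) (e + 1) η = majority (2 * m + 1) (e + 1) ζ :=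
    majority_congr fun y _ _ => h y ⟨by omega, by omega⟩
  have h₄ : majority (2 * m + 1) (e - (2 * m + 1 : ℕ) + 1) η
      = majority (2 * m + 1) (e - (2 * m + 1 : ℕ) + 1) ζ :=
    majority_congr fun y _ _ => h y ⟨by omega, by omega⟩
  unfold deficit gainLeftEnd gainRightEnd
  rw [hw e (by omega) (by omega), h₁, h₂, h₃, h₄, h e ⟨by omega, by omega⟩,
    h (e + 1) ⟨by omega, by omega⟩]

/-- The indicator of walls at both `a` and `a + d`. -/
noncomputable def wallPair (d : ℕ) (a : ℤ) (η : Config ℤ) : ℝ := wall a η * wall (a + d) η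

lemma wallPair_nonneg (d : ℕ) (a : ℤ) (η : Config ℤ) : 0 ≤ wallPair d a η :=
  mul_nonneg (wall_nonneg _ _) (wall_nonneg _ _)

lemma dependsOn_wallPair {d : ℕ} {a b c : ℤ} (hb : b ≤ a) (hc : a + d + 1 ≤ c) :
    DependsOn (wallPair d a) (Set.Icc b c) := by
  intro η ζ h
  unfold wallPair
  rw [dependsOn_wall hb (by omega) h, dependsOn_wall (e := a + d) (by omega) hc h]

/-- If there is a wall at `a` and the deficit at `a + 1` is below one, then there is no wall at
`a + 1`, and updating the block that ends at `a + 1` moves the wall from `a` to `a + 1`. -/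
lemma one_le_deficit_or_move {m : ℕ} (hm : 1 ≤ m) {a : ℤ} {η : Config ℤ} (ha : wall a η = 1) :
    1 ≤ deficit m (a + 1) η ∨
      wall (a + 1) η = 0 ∧
        wall (a + 1) (update (2 * m + 1) (a + 1 - (2 * m + 1 : ℕ) + 1) η) = 1 := by
  by_cases h : 0 < gainRightEnd (2 * m + 1) (a + 1) η
  · right
    rw [wall_update_right (by omega)]
    rcases wall_eq_zero_or_one (a + 1) η with h0 | h1
    · refine ⟨h0, ?_⟩
      unfold gainRightEnd at h
      split_ifs at h ⊢ with h'
      · rfl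
      · linarith
    · exfalso
      unfold gainRightEnd at h
      split_ifs at h <;> linarith
  · left
    have h₁ := Finset.single_le_sum (f := fun j : ℕ => wall (a + 1 - 1 - j) η)
      (fun i _ => wall_nonneg _ _) (Finset.mem_range.2 (show 0 < m by omega))
    simp only [Nat.cast_zero, sub_zero, add_sub_cancel_right, ha] at h₁
    have h₂ := gainLeftEnd_le m (a + 1) η
    unfold deficit
    simp only [add_sub_cancel_right]
    linarith

lemma wallPair_one_le_deficit {m : ℕ} (hm : 1 ≤ m) (a : ℤ) (η : Config ℤ) :
    wallPair 1 a η ≤ deficit m (a + 1) η := by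
  unfold wallPair
  have h0 := deficit_nonneg m (a + 1) η
  rcases wall_eq_zero_or_one a η with h | h
  · simpa [h] using h0
  rcases one_le_deficit_or_move hm h with h' | ⟨h', -⟩
  · rw [h, one_mul]
    exact (wall_le_one _ _).trans h'
  · simpa [h'] using h0

/-- A block update brings two walls closer together, unless there is a deficit. -/
lemma wallPair_succ_sub_deficit_le {m : ℕ} (hm : 1 ≤ m) {d : ℕ} (hd : 1 ≤ d) (a : ℤ)
    (η : Config ℤ) :
    wallPair (d + 1) a η - deficit m (a + 1) η
      ≤ wallPair d (a + 1) (update (2 * m + 1) (a + 1 - (2 * m + 1 : ℕ) + 1) η) := by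
  have h0 := deficit_nonneg m (a + 1) η
  have hr := wallPair_nonneg d (a + 1) (update (2 * m + 1) (a + 1 - (2 * m + 1 : ℕ) + 1) η)
  rcases wall_eq_zero_or_one a η with h | h
  · have : wallPair (d + 1) a η = 0 := by simp [wallPair, h]
    linarith
  rcases one_le_deficit_or_move hm h with h' | ⟨-, h'⟩
  · have : wallPair (d + 1) a η ≤ 1 := by
      simpa [wallPair, h] using wall_le_one _ _
    linarith
  · have : wallPair d (a + 1) (update (2 * m + 1) (a + 1 - (2 * m + 1 : ℕ) + 1) η)
        = wallPair (d + 1) a η := by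
      unfold wallPair
      rw [h', h]
      congr 1
      unfold wall
      rw [update_of_ge η (by omega), update_of_ge η (by omega)]
      push_cast
      ring_nf
    linarith

lemma sum_range_le_one_add_pairs {p : ℕ → ℝ} (hp : ∀ i, p i = 0 ∨ p i = 1) (D : ℕ) :
    ∑ i ∈ Finset.range D, p i
      ≤ 1 + ∑ j ∈ Finset.range D, ∑ i ∈ Finset.range j, p i * p j := by
  have h0 : ∀ i, 0 ≤ p i := fun i => by rcases hp i with h | h <;> simp [h]
  have hpair : ∀ D, 0 ≤ ∑ j ∈ Finset.range D, ∑ i ∈ Finset.range j, p i * p j := fun D =>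
    Finset.sum_nonneg fun j _ => Finset.sum_nonneg fun i _ => mul_nonneg (h0 i) (h0 j)
  induction D with
  | zero => simp
  | succ D ih =>
    rw [Finset.sum_range_succ, Finset.sum_range_succ]
    rcases hp D with h | h
    · simpa [h] using ih
    · rw [← Finset.sum_mul, h, mul_one]
      by_cases hex : ∃ i ∈ Finset.range D, p i = 1
      · obtain ⟨i, hi, hi1⟩ := hex
        have := Finset.single_le_sum (f := p) (fun i _ => h0 i) hi
        linarith
      · push Not at hex
        have : ∑ i ∈ Finset.range D, p i = 0 :=
          Finset.sum_eq_zero fun i hi => (hp i).resolve_right (hex i hi)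
        have := hpair D
        linarith

/-! ### Local functions -/

lemma exists_eq_comp_domRestrict {f : Config ℤ → ℝ} {a b : ℤ} (hf : DependsOn f (Set.Icc a b)) :
    ∃ g : (Set.Icc a b → Bool) → ℝ, f = g ∘ (Set.Icc a b).domRestrict :=
  dependsOn_iff_exists_comp.1 hf

lemma measurable_of_dependsOn {f : Config ℤ → ℝ} {a b : ℤ} (hf : DependsOn f (Set.Icc a b)) :
    Measurable f := by
  obtain ⟨g, rfl⟩ := exists_eq_comp_domRestrict hf
  exact (measurable_of_finite g).comp (measurable_pi_lambda _ fun i => measurable_pi_apply _)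

lemma continuous_of_dependsOn {f : Config ℤ → ℝ} {a b : ℤ} (hf : DependsOn f (Set.Icc a b)) :
    Continuous f := by
  obtain ⟨g, rfl⟩ := exists_eq_comp_domRestrict hf
  exact (continuous_of_discreteTopology (f := g)).comp
    (continuous_pi fun i => continuous_apply _)

lemma exists_abs_le_of_dependsOn {f : Config ℤ → ℝ} {a b : ℤ} (hf : DependsOn f (Set.Icc a b)) :
    ∃ K, ∀ η, |f η| ≤ K := by
  obtain ⟨g, rfl⟩ := exists_eq_comp_domRestrict hf
  obtain ⟨K, hK⟩ := (Set.finite_range fun ζ => |g ζ|).bddAbove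
  exact ⟨K, fun η => hK ⟨_, rfl⟩⟩

lemma isLocal_of_dependsOn {f : Config ℤ → ℝ} {a b : ℤ} (hf : DependsOn f (Set.Icc a b)) :
    IsLocal f :=
  ⟨Finset.Icc a b, by rwa [Finset.coe_Icc]⟩

lemma dependsOn_comp_update {n : ℕ} {f : Config ℤ → ℝ} {a b x : ℤ}
    (hf : DependsOn f (Set.Icc a b)) (hx : x ∈ Finset.Icc (a - n + 1) b) :
    DependsOn (fun η => f (update n x η)) (Set.Icc (a - n) (b + n)) := by
  intro η ζ h
  rw [Finset.mem_Icc] at hx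
  refine hf fun y hy => ?_
  rw [Set.mem_Icc] at hy
  have hm : majority n x η = majority n x ζ :=
    majority_congr fun z _ _ => h z ⟨by omega, by omega⟩
  unfold update setOpinion
  rw [hm, h y ⟨by omega, by omega⟩]

lemma dependsOn_generator {n : ℕ} {f : Config ℤ → ℝ} {a b : ℤ} (hf : DependsOn f (Set.Icc a b)) :
    DependsOn (generator (block n) f) (Set.Icc (a - n) (b + n)) := by
  intro η ζ h
  rw [generator_eq_sum hf le_rfl, generator_eq_sum hf le_rfl]
  refine Finset.sum_congr rfl fun x hx => ?_
  have h₁ : f (update n x η) = f (update n x ζ) := dependsOn_comp_update hf hx h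
  rw [h₁, hf.mono (Set.Icc_subset_Icc (by omega) (by omega)) h]

/-- A nonnegative local function decays at most at the rate `b + n - a` at which the blocks that
meet its window `[a, b]` are updated. -/
lemma generator_ge_neg {n : ℕ} {f : Config ℤ → ℝ} {a b : ℤ} (hf : DependsOn f (Set.Icc a b))
    (hf0 : ∀ η, 0 ≤ f η) {C : ℝ} (hC : ((b + n - a).toNat : ℝ) ≤ C) (η : Config ℤ) :
    -(C * f η) ≤ generator (block n) f η := by
  rw [generator_eq_sum hf le_rfl]
  calc -(C * f η) ≤ -((b + n - a).toNat * f η) :=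
        neg_le_neg (mul_le_mul_of_nonneg_right hC (hf0 η))
    _ = ∑ x ∈ Finset.Icc (a - n + 1) b, -f η := by
        rw [Finset.sum_const, Int.card_Icc, nsmul_eq_mul, mul_neg,
          show b + 1 - (a - n + 1) = b + n - a by ring]
    _ ≤ _ := Finset.sum_le_sum fun x _ => by linarith [hf0 (update n x η)]

lemma update_sub_le_generator {n : ℕ} {f : Config ℤ → ℝ} {a b : ℤ}
    (hf : DependsOn f (Set.Icc a b)) (hf0 : ∀ η, 0 ≤ f η) {C : ℝ}
    (hC : ((b + n - a).toNat : ℝ) ≤ C) {x : ℤ} (hx : x ∈ Finset.Icc (a - n + 1) b)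
    (η : Config ℤ) :
    f (update n x η) - C * f η ≤ generator (block n) f η := by
  rw [generator_eq_sum hf le_rfl, Finset.sum_sub_distrib, Finset.sum_const, Int.card_Icc,
    nsmul_eq_mul, show b + 1 - (a - n + 1) = b + n - a by ring]
  have h₁ := Finset.single_le_sum (f := fun x => f (update n x η)) (fun x _ => hf0 _) hx
  have h₂ := mul_le_mul_of_nonneg_right hC (hf0 η)
  linarith

/-! ### The forward equation -/

/-- A right-continuous real process with measurable marginals is jointly measurable: at time `s` it
is the limit of its values at the times `(⌊k s⌋ + 1) / k`, which lie to the right of `s`. -/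
lemma measurable_uncurry_of_rightContinuous {Ω : Type*} [MeasurableSpace Ω] {Y : ℝ≥0 → Ω → ℝ}
    (hm : ∀ t, Measurable (Y t))
    (hc : ∀ ω t, ContinuousWithinAt (fun s => Y s ω) (Set.Ici t) t) :
    Measurable fun p : ℝ≥0 × Ω => Y p.1 p.2 := by
  obtain ⟨τ, hτ, hτ'⟩ : ∃ τ : ℕ → ℕ → ℝ≥0, (∀ k (s : ℝ≥0), s ≤ τ k ⌊(k + 1) * s⌋₊) ∧
      ∀ k (s : ℝ≥0), τ k ⌊(k + 1) * s⌋₊ ≤ s + 1 / (k + 1) := by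
    refine ⟨fun k i => (i + 1) / (k + 1), fun k s => ?_, fun k s => ?_⟩
    · have h := (Nat.lt_floor_add_one (((k : ℝ≥0) + 1) * s)).le
      rw [le_div_iff₀ (by positivity), mul_comm]
      exact h
    · have h := Nat.floor_le (show 0 ≤ ((k : ℝ≥0) + 1) * s by positivity)
      have h₁ : (s + 1 / (k + 1)) * ((k : ℝ≥0) + 1) = (k + 1) * s + 1 := by field_simp
      rw [div_le_iff₀ (by positivity), h₁]
      gcongr
  refine measurable_of_tendsto_metrizable
    (f := fun (k : ℕ) (p : ℝ≥0 × Ω) => Y (τ k ⌊(k + 1) * p.1⌋₊) p.2) (fun k => ?_) ?_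
  · have h₁ : Measurable (Function.uncurry fun (i : ℕ) ω => Y (τ k i) ω) :=
      measurable_from_prod_countable_right fun i => hm (τ k i)
    have h₂ : Measurable fun p : ℝ≥0 × Ω => ⌊((k : ℝ≥0) + 1) * p.1⌋₊ :=
      Nat.measurable_floor.comp (measurable_fst.const_mul ((k : ℝ≥0) + 1))
    exact h₁.comp (h₂.prodMk measurable_snd)
  · rw [tendsto_pi_nhds]
    rintro ⟨s, ω⟩
    refine (hc ω s).tendsto.comp (tendsto_nhdsWithin_iff.2 ⟨?_, Eventually.of_forall (hτ · s)⟩)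
    refine tendsto_of_tendsto_of_tendsto_of_le_of_le tendsto_const_nhds ?_ (hτ · s) (hτ' · s)
    simpa using tendsto_const_nhds (x := s) |>.add
      (tendsto_one_div_add_atTop_nhds_zero_nat (𝕜 := ℝ≥0))

section ForwardEquation

variable {Ω : Type*} {mΩ : MeasurableSpace Ω} {n : ℕ} {η₀ : Config ℤ} {P : Measure Ω}
  {ℱ : Filtration ℝ≥0 mΩ} {η : ℝ≥0 → Ω → Config ℤ}

/-- The expectation of `f` at time `t`; real times are used for calculus, and negative times are
read as time zero. -/
noncomputable def mean (P : Measure Ω) (η : ℝ≥0 → Ω → Config ℤ) (f : Config ℤ → ℝ) (t : ℝ) : ℝ :=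
  ∫ ω, f (η t.toNNReal ω) ∂P

lemma IsMajorityRuleProcess.measurable (hη : IsMajorityRuleProcess n η₀ P ℱ η) (t : ℝ≥0) :
    Measurable (η t) :=
  (hη.adapted t).mono (ℱ.le t) le_rfl

lemma mean_nonneg {f : Config ℤ → ℝ} (hf : ∀ ζ, 0 ≤ f ζ) (t : ℝ) : 0 ≤ mean P η f t :=
  integral_nonneg fun _ => hf _

lemma IsMajorityRuleProcess.measurable_uncurry (hη : IsMajorityRuleProcess n η₀ P ℱ η)
    {f : Config ℤ → ℝ} {a b : ℤ} (hf : DependsOn f (Set.Icc a b)) :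
    Measurable (Function.uncurry fun (s : ℝ) ω => f (η s.toNNReal ω)) := by
  have h := measurable_uncurry_of_rightContinuous (Y := fun t ω => f (η t ω))
    (fun t => (measurable_of_dependsOn hf).comp (hη.measurable t))
    (fun ω t => (continuous_of_dependsOn hf).continuousAt.comp_continuousWithinAt
      (hη.right_continuous ω t))
  exact h.comp ((measurable_real_toNNReal.comp measurable_fst).prodMk measurable_snd)

variable [IsProbabilityMeasure P]

lemma IsMajorityRuleProcess.integrable (hη : IsMajorityRuleProcess n η₀ P ℱ η)
    {f : Config ℤ → ℝ} {a b : ℤ} (hf : DependsOn f (Set.Icc a b)) (t : ℝ≥0) :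
    Integrable (fun ω => f (η t ω)) P := by
  obtain ⟨K, hK⟩ := exists_abs_le_of_dependsOn hf
  exact Integrable.of_bound
    ((measurable_of_dependsOn hf).comp (hη.measurable t)).aestronglyMeasurable K
    (Eventually.of_forall fun ω => hK _)

lemma mean_mono (hη : IsMajorityRuleProcess n η₀ P ℱ η) {f g : Config ℤ → ℝ} {a b c d : ℤ}
    (hf : DependsOn f (Set.Icc a b)) (hg : DependsOn g (Set.Icc c d)) (h : ∀ ζ, f ζ ≤ g ζ)
    (t : ℝ) : mean P η f t ≤ mean P η g t :=
  integral_mono (hη.integrable hf _) (hη.integrable hg _) fun _ => h _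

lemma integrable_mean (hη : IsMajorityRuleProcess n η₀ P ℱ η) {f : Config ℤ → ℝ} {a b : ℤ}
    (hf : DependsOn f (Set.Icc a b)) (c d : ℝ) :
    IntervalIntegrable (mean P η f) volume c d := by
  obtain ⟨K, hK⟩ := exists_abs_le_of_dependsOn hf
  have hm : StronglyMeasurable (mean P η f) :=
    (hη.measurable_uncurry hf).stronglyMeasurable.integral_prod_right
  refine (intervalIntegrable_const (c := K)).mono_fun hm.aestronglyMeasurable
    (Eventually.of_forall fun s => ?_)
  have hK0 : 0 ≤ K := (abs_nonneg _).trans (hK η₀)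
  rw [Real.norm_of_nonneg hK0]
  have := norm_integral_le_of_norm_le_const (μ := P) (f := fun ω => f (η s.toNNReal ω)) (C := K)
    (Eventually.of_forall fun ω => hK _)
  simpa [mean] using this

lemma mean_eq_add_integral (hη : IsMajorityRuleProcess n η₀ P ℱ η) {f : Config ℤ → ℝ} {a b : ℤ}
    (hf : DependsOn f (Set.Icc a b)) (t : ℝ≥0) :
    mean P η f t = mean P η f 0 + ∫ s in (0 : ℝ)..t, mean P η (generator (block n) f) s := by
  have hg := dependsOn_generator (n := n) hf
  obtain ⟨K, hK⟩ := exists_abs_le_of_dependsOn hg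
  have hM := hη.martingale f (isLocal_of_dependsOn hf)
  have h := hM.setIntegral_eq (zero_le (a := t)) MeasurableSet.univ
  have hint : Integrable
      (fun ω => ∫ s in (0 : ℝ)..t, generator (block n) f (η s.toNNReal ω)) P := by
    have := (hη.integrable hf t).sub (hM.integrable t)
    refine this.congr (Eventually.of_forall fun ω => ?_)
    simp only [Pi.sub_apply, sub_sub_cancel]
  have : IsFiniteMeasure (volume.restrict (Set.uIoc (0 : ℝ) t)) := ⟨by simp⟩
  have hprod : Integrable (Function.uncurry fun (s : ℝ) ω => generator (block n) f (η s.toNNReal ω))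
      ((volume.restrict (Set.uIoc (0 : ℝ) t)).prod P) :=
    Integrable.of_bound (hη.measurable_uncurry hg).aestronglyMeasurable K
      (Eventually.of_forall fun p => hK _)
  simp only [Measure.restrict_univ, NNReal.coe_zero, intervalIntegral.integral_same, sub_zero] at h
  rw [integral_sub (hη.integrable hf t) hint, ← intervalIntegral_integral_swap hprod] at h
  simp only [mean, Real.toNNReal_coe, Real.toNNReal_zero]
  linarith

lemma mean_eq_add_integral_max (hη : IsMajorityRuleProcess n η₀ P ℱ η) {f : Config ℤ → ℝ}
    {a b : ℤ} (hf : DependsOn f (Set.Icc a b)) (t : ℝ) :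
    mean P η f t = mean P η f 0
      + ∫ s in (0 : ℝ)..max t 0, mean P η (generator (block n) f) s := by
  rw [← Real.coe_toNNReal', ← mean_eq_add_integral hη hf, Real.coe_toNNReal']
  simp only [mean, ← Real.coe_toNNReal', Real.toNNReal_coe]

lemma continuous_mean (hη : IsMajorityRuleProcess n η₀ P ℱ η) {f : Config ℤ → ℝ} {a b : ℤ}
    (hf : DependsOn f (Set.Icc a b)) : Continuous (mean P η f) := by
  rw [funext (mean_eq_add_integral_max hη hf)]
  exact continuous_const.add ((intervalIntegral.continuous_primitive
    (fun c d => integrable_mean hη (dependsOn_generator hf) c d) 0).comp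
      (continuous_id.max continuous_const))

/-- The forward equation for the expectation of a local function. -/
lemma hasDerivAt_mean (hη : IsMajorityRuleProcess n η₀ P ℱ η) {f : Config ℤ → ℝ} {a b : ℤ}
    (hf : DependsOn f (Set.Icc a b)) {t : ℝ} (ht : 0 < t) :
    HasDerivAt (mean P η f) (mean P η (generator (block n) f) t) t := by
  have h := ((continuous_mean hη (dependsOn_generator (n := n) hf)).integral_hasStrictDerivAt
    0 t).hasDerivAt.const_add (mean P η f 0)
  refine h.congr_of_eventuallyEq ?_
  filter_upwards [lt_mem_nhds ht] with s hs
  rw [mean_eq_add_integral_max hη hf, max_eq_left hs.le]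

lemma neg_mul_mean_le_mean_generator (hη : IsMajorityRuleProcess n η₀ P ℱ η)
    {f : Config ℤ → ℝ} {a b : ℤ} (hf : DependsOn f (Set.Icc a b)) (hf0 : ∀ ζ, 0 ≤ f ζ) {C : ℝ}
    (hC : ((b + n - a).toNat : ℝ) ≤ C) (t : ℝ) :
    -(C * mean P η f t) ≤ mean P η (generator (block n) f) t := by
  unfold mean
  rw [← integral_const_mul, ← integral_neg]
  exact integral_mono ((hη.integrable hf _).const_mul C).neg
    (hη.integrable (dependsOn_generator hf) _) fun ω => generator_ge_neg hf hf0 hC _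

end ForwardEquation

/-! ### A comparison lemma for differential inequalities -/

/-- If `φ ≥ 0` is fed by `ψ`, and both decay at rate at most `C`, then `ψ` is bounded by the value
of `φ` one unit of time later. -/
lemma le_exp_mul_of_deriv_ge {φ φ' ψ ψ' : ℝ → ℝ} {C t : ℝ}
    (hφc : Continuous φ) (hψc : Continuous ψ)
    (hφ : ∀ s, t < s → HasDerivAt φ (φ' s) s) (hψ : ∀ s, t < s → HasDerivAt ψ (ψ' s) s)
    (hφ' : ∀ s, t < s → ψ s - C * φ s ≤ φ' s) (hψ' : ∀ s, t < s → -(C * ψ s) ≤ ψ' s)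
    (hφ0 : 0 ≤ φ t) : ψ t ≤ Real.exp C * φ (t + 1) := by
  have hexp : ∀ s, HasDerivAt (fun s => Real.exp (C * (s - t))) (C * Real.exp (C * (s - t))) s := by
    intro s
    have := (((hasDerivAt_id s).sub_const t).const_mul C).exp
    simpa [mul_comm] using this
  have hexpc : Continuous fun s => Real.exp (C * (s - t)) := by fun_prop
  have hψmono : MonotoneOn (fun s => Real.exp (C * (s - t)) * ψ s) (Set.Ici t) := by
    have hd : ∀ s, t < s → HasDerivAt (fun s => Real.exp (C * (s - t)) * ψ s)
        (C * Real.exp (C * (s - t)) * ψ s + Real.exp (C * (s - t)) * ψ' s) s :=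
      fun s hs => (hexp s).mul (hψ s hs)
    refine monotoneOn_of_deriv_nonneg (convex_Ici t) (hexpc.mul hψc).continuousOn ?_ ?_
    · rw [interior_Ici]
      exact fun s hs => (hd s hs).differentiableAt.differentiableWithinAt
    · rw [interior_Ici]
      intro s hs
      rw [(hd s hs).deriv]
      nlinarith [Real.exp_pos (C * (s - t)), hψ' s hs]
  have hφmono : MonotoneOn (fun s => Real.exp (C * (s - t)) * φ s - (s - t) * ψ t)
      (Set.Ici t) := by
    have hd : ∀ s, t < s → HasDerivAt (fun s => Real.exp (C * (s - t)) * φ s - (s - t) * ψ t)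
        (C * Real.exp (C * (s - t)) * φ s + Real.exp (C * (s - t)) * φ' s - 1 * ψ t) s :=
      fun s hs => ((hexp s).mul (hφ s hs)).sub (((hasDerivAt_id s).sub_const t).mul_const (ψ t))
    refine monotoneOn_of_deriv_nonneg (convex_Ici t) (by fun_prop) ?_ ?_
    · rw [interior_Ici]
      exact fun s hs => (hd s hs).differentiableAt.differentiableWithinAt
    · rw [interior_Ici]
      intro s hs
      rw [(hd s hs).deriv]
      have h₁ := hψmono Set.self_mem_Ici (Set.mem_Ici.2 (le_of_lt hs)) (le_of_lt hs)
      simp only [sub_self, mul_zero, Real.exp_zero, one_mul] at h₁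
      nlinarith [Real.exp_pos (C * (s - t)), hφ' s hs]
  have h := hφmono Set.self_mem_Ici (Set.mem_Ici.2 (by linarith : t ≤ t + 1))
    (by linarith : t ≤ t + 1)
  simp only [sub_self, mul_zero, Real.exp_zero, one_mul, zero_mul, sub_zero,
    add_sub_cancel_left, mul_one] at h
  linarith

/-! ### The density of walls -/

section Density

variable {Ω : Type*} {mΩ : MeasurableSpace Ω} {m : ℕ} {η₀ : Config ℤ} {P : Measure Ω}
  [IsProbabilityMeasure P] {ℱ : Filtration ℝ≥0 mΩ} {η : ℝ≥0 → Ω → Config ℤ}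

lemma hasDerivAt_mean_wall (hη : IsMajorityRuleProcess (2 * m + 1) η₀ P ℱ η) (e : ℤ) {t : ℝ}
    (ht : 0 < t) :
    HasDerivAt (mean P η (wall e))
      (∑ j ∈ Finset.range m, mean P η (wall (e + 1 + j)) t
        + ∑ j ∈ Finset.range m, mean P η (wall (e - 1 - j)) t
        - 2 * m * mean P η (wall e) t - mean P η (deficit m e) t) t := by
  have h := hasDerivAt_mean hη (dependsOn_wall (le_refl e) le_rfl) ht
  convert h using 1
  have hi : ∀ y, Integrable (fun ω => wall y (η t.toNNReal ω)) P := fun y =>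
    hη.integrable (dependsOn_wall (le_refl y) le_rfl) _
  have hd : Integrable (fun ω => deficit m e (η t.toNNReal ω)) P :=
    hη.integrable (dependsOn_deficit le_rfl le_rfl) _
  unfold mean
  simp_rw [generator_wall_eq_sub_deficit]
  have h₁ : Integrable (fun ω => ∑ j ∈ Finset.range m, wall (e + 1 + j) (η t.toNNReal ω)) P :=
    integrable_finsetSum _ fun j _ => hi _
  have h₂ : Integrable (fun ω => ∑ j ∈ Finset.range m, wall (e - 1 - j) (η t.toNNReal ω)) P :=
    integrable_finsetSum _ fun j _ => hi _
  have h₃ := (hi e).const_mul (2 * m : ℝ)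
  have h₄ : Integrable (fun ω => ∑ j ∈ Finset.range m, wall (e + 1 + j) (η t.toNNReal ω)
      + ∑ j ∈ Finset.range m, wall (e - 1 - j) (η t.toNNReal ω)) P := h₁.add h₂
  have h₅ : Integrable (fun ω => ∑ j ∈ Finset.range m, wall (e + 1 + j) (η t.toNNReal ω)
      + ∑ j ∈ Finset.range m, wall (e - 1 - j) (η t.toNNReal ω)
      - 2 * m * wall e (η t.toNNReal ω)) P := h₄.sub h₃
  rw [integral_sub h₅ hd, integral_sub h₄ h₃, integral_add h₁ h₂,
    integral_finsetSum _ fun j _ => hi _, integral_finsetSum _ fun j _ => hi _,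
    integral_const_mul]

/-- Suppose that the wall densities are at most `c` from time `T` on. Anything that feeds the gap
between `c` and the density at `e` is bounded by that gap one unit of time later. -/
lemma le_exp_mul_gap (hη : IsMajorityRuleProcess (2 * m + 1) η₀ P ℱ η) {T c : ℝ} (hT : 0 ≤ T)
    (hc : ∀ t, T ≤ t → ∀ e, mean P η (wall e) t ≤ c) {C t : ℝ} (ht : T ≤ t) (e : ℤ)
    {ψ ψ' : ℝ → ℝ} (hψc : Continuous ψ) (hψ : ∀ s, t < s → HasDerivAt ψ (ψ' s) s)
    (hψ' : ∀ s, t < s → -(C * ψ s) ≤ ψ' s)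
    (hle : ∀ s, t < s → ψ s - C * (c - mean P η (wall e) s)
      ≤ ∑ j ∈ Finset.range m, (c - mean P η (wall (e + 1 + j)) s)
        + ∑ j ∈ Finset.range m, (c - mean P η (wall (e - 1 - j)) s)
        - 2 * m * (c - mean P η (wall e) s) + mean P η (deficit m e) s) :
    ψ t ≤ Real.exp C * (c - mean P η (wall e) (t + 1)) := by
  refine le_exp_mul_of_deriv_ge (φ := fun s => c - mean P η (wall e) s)
    (continuous_const.sub (continuous_mean hη (dependsOn_wall (le_refl e) le_rfl))) hψc
    (fun s hs => (hasDerivAt_mean_wall hη e (by linarith)).const_sub c) hψ ?_ hψ'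
    (sub_nonneg.2 (hc t ht e))
  intro s hs
  refine (hle s hs).trans (le_of_eq ?_)
  simp only [Finset.sum_sub_distrib, Finset.sum_const, Finset.card_range, nsmul_eq_mul]
  ring

/-- The constant `6 * m + 3` is the number of blocks that meet the window on which the deficit
depends, hence a bound for the rate at which the expected deficit can decay. -/
lemma mean_deficit_le_gap (hη : IsMajorityRuleProcess (2 * m + 1) η₀ P ℱ η) {T c : ℝ}
    (hT : 0 ≤ T) (hc : ∀ t, T ≤ t → ∀ e, mean P η (wall e) t ≤ c) {C t : ℝ} (ht : T ≤ t)
    (hC : 6 * m + 3 ≤ C) (e : ℤ) :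
    mean P η (deficit m e) t ≤ Real.exp C * (c - mean P η (wall e) (t + 1)) := by
  have hdep : DependsOn (deficit m e) (Set.Icc (e - (2 * m + 1)) (e + (2 * m + 1))) :=
    dependsOn_deficit le_rfl le_rfl
  refine le_exp_mul_gap hη hT hc ht e (continuous_mean hη hdep)
    (fun s hs => hasDerivAt_mean hη hdep (by linarith)) (fun s hs => ?_) (fun s hs => ?_)
  · have hC' : (((e + (2 * m + 1)) + (2 * m + 1 : ℕ) - (e - (2 * m + 1))).toNat : ℝ) ≤ C := by
      refine le_trans (le_of_eq ?_) hC
      rw [show ((e + (2 * m + 1)) + (2 * m + 1 : ℕ) - (e - (2 * m + 1))).toNat = 6 * m + 3 by omega]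
      push_cast
      ring
    exact neg_mul_mean_le_mean_generator hη hdep (deficit_nonneg m e) hC' s
  · have h₁ : ∀ y, 0 ≤ c - mean P η (wall y) s := fun y => sub_nonneg.2 (hc s (by linarith) y)
    have h₂ := Finset.sum_nonneg fun (j : ℕ) (_ : j ∈ Finset.range m) => h₁ (e + 1 + j)
    have h₃ := Finset.sum_nonneg fun (j : ℕ) (_ : j ∈ Finset.range m) => h₁ (e - 1 - j)
    have h₄ : 2 * m * (c - mean P η (wall e) s) ≤ C * (c - mean P η (wall e) s) :=
      mul_le_mul_of_nonneg_right (by linarith [(Nat.cast_nonneg m : (0 : ℝ) ≤ m)]) (h₁ e)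
    linarith

/-- The gap at `e` is fed by the gaps at the neighbouring sites; it also bounds its own past. -/
lemma gap_le_gap (hη : IsMajorityRuleProcess (2 * m + 1) η₀ P ℱ η) (hm : 1 ≤ m) {T c : ℝ}
    (hT : 0 ≤ T) (hc : ∀ t, T ≤ t → ∀ e, mean P η (wall e) t ≤ c) {C t : ℝ} (ht : T ≤ t)
    (hC : 6 * m + 3 ≤ C) (e y : ℤ) (hy : y = e ∨ y = e + 1 ∨ y = e - 1) :
    c - mean P η (wall y) t ≤ Real.exp C * (c - mean P η (wall e) (t + 1)) := by
  have hm0 : (0 : ℝ) ≤ m := Nat.cast_nonneg m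
  have hgap : ∀ s, t < s → ∀ y, 0 ≤ c - mean P η (wall y) s := fun s hs y =>
    sub_nonneg.2 (hc s (by linarith) y)
  have hsum : ∀ s, t < s → 0 ≤ ∑ j ∈ Finset.range m, (c - mean P η (wall (e + 1 + j)) s)
      ∧ 0 ≤ ∑ j ∈ Finset.range m, (c - mean P η (wall (e - 1 - j)) s) := fun s hs =>
    ⟨Finset.sum_nonneg fun j _ => hgap s hs _, Finset.sum_nonneg fun j _ => hgap s hs _⟩
  refine le_exp_mul_gap (ψ := fun s => c - mean P η (wall y) s) hη hT hc ht e
    (continuous_const.sub (continuous_mean hη (dependsOn_wall (le_refl y) le_rfl)))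
    (fun s hs => (hasDerivAt_mean_wall hη y (by linarith)).const_sub c)
    (fun s hs => ?_) (fun s hs => ?_)
  · have h₁ := Finset.sum_nonneg fun (j : ℕ) (_ : j ∈ Finset.range m) => hgap s hs (y + 1 + j)
    have h₂ := Finset.sum_nonneg fun (j : ℕ) (_ : j ∈ Finset.range m) => hgap s hs (y - 1 - j)
    have h₃ := mean_nonneg (P := P) (η := η) (deficit_nonneg m y) s
    have h₄ : 2 * m * (c - mean P η (wall y) s) ≤ C * (c - mean P η (wall y) s) :=
      mul_le_mul_of_nonneg_right (by linarith) (hgap s hs y)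
    simp only [Finset.sum_sub_distrib, Finset.sum_const, Finset.card_range, nsmul_eq_mul] at h₁ h₂
    linarith
  · have h₁ := mean_nonneg (P := P) (η := η) (deficit_nonneg m e) s
    have h₂ : (2 * m + 1) * (c - mean P η (wall e) s) ≤ C * (c - mean P η (wall e) s) :=
      mul_le_mul_of_nonneg_right (by linarith) (hgap s hs e)
    obtain ⟨hr, hl⟩ := hsum s hs
    have h0 := Finset.mem_range.2 (show 0 < m by omega)
    rcases hy with rfl | rfl | rfl
    · linarith
    · have h₃ := Finset.single_le_sum (f := fun j : ℕ => c - mean P η (wall (e + 1 + j)) s)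
        (fun j _ => hgap s hs _) h0
      simp only [Nat.cast_zero, add_zero] at h₃
      linarith [hgap s hs e]
    · have h₃ := Finset.single_le_sum (f := fun j : ℕ => c - mean P η (wall (e - 1 - j)) s)
        (fun j _ => hgap s hs _) h0
      simp only [Nat.cast_zero, sub_zero] at h₃
      linarith [hgap s hs e]

/-- The gap at one site controls all earlier gaps in the backward light cone of that site. -/
lemma gap_le_pow_mul (hη : IsMajorityRuleProcess (2 * m + 1) η₀ P ℱ η) (hm : 1 ≤ m) {T c : ℝ}
    (hT : 0 ≤ T) (hc : ∀ t, T ≤ t → ∀ e, mean P η (wall e) t ≤ c) {C : ℝ}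
    (hC : 6 * m + 3 ≤ C) {δ : ℝ} (i : ℕ) :
    ∀ {t : ℝ} {e y : ℤ}, T ≤ t → c - mean P η (wall e) (t + i) ≤ δ → |y - e| ≤ i →
      c - mean P η (wall y) t ≤ Real.exp C ^ i * δ := by
  induction i with
  | zero =>
    intro t e y _ h hy
    obtain rfl : y = e := by
      rw [abs_le] at hy
      omega
    simpa using h
  | succ i ih =>
    intro t e y ht h hy
    obtain ⟨z, hz, hyz⟩ : ∃ z, |z - e| ≤ (i : ℤ) ∧ (y = z ∨ y = z + 1 ∨ y = z - 1) := by
      rw [abs_le] at hy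
      push_cast at hy
      rcases lt_trichotomy y e with h | h | h
      · exact ⟨y + 1, by rw [abs_le]; omega, by omega⟩
      · exact ⟨y, by rw [abs_le]; omega, by omega⟩
      · exact ⟨y - 1, by rw [abs_le]; omega, by omega⟩
    have h₁ := ih (t := t + 1) (by linarith) (by convert h using 3; push_cast; ring) hz
    refine (gap_le_gap hη hm hT hc ht hC z y hyz).trans ?_
    rw [pow_succ', mul_assoc]
    exact mul_le_mul_of_nonneg_left h₁ (Real.exp_pos C).le

/-- Two walls at distance `d + 1` without a deficit turn at rate at least one into two walls at
distance `d`. -/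
lemma mean_wallPair_succ_le (hη : IsMajorityRuleProcess (2 * m + 1) η₀ P ℱ η) (hm : 1 ≤ m)
    {C t : ℝ} (ht : 0 ≤ t) {d : ℕ} (hd : 1 ≤ d) (hC : 6 * m + 5 + d ≤ C) (a : ℤ) :
    mean P η (wallPair (d + 1) a) t ≤ mean P η (deficit m (a + 1)) t
      + Real.exp C * mean P η (wallPair d (a + 1)) (t + 1) := by
  set h : Config ℤ → ℝ := fun ζ => max (wallPair (d + 1) a ζ - deficit m (a + 1) ζ) 0 with hh
  have hdepP : DependsOn (wallPair (d + 1) a) (Set.Icc a (a + d + 2)) :=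
    dependsOn_wallPair le_rfl (by push_cast; omega)
  have hdepG : DependsOn (deficit m (a + 1)) (Set.Icc (a - 2 * m) (a + 2 * m + 2)) :=
    dependsOn_deficit (by omega) (by omega)
  have hdepH : DependsOn h (Set.Icc (a - 2 * m) (a + 2 * m + 2 + d)) := by
    intro η ζ hηζ
    simp only [hh]
    rw [hdepP.mono (Set.Icc_subset_Icc (by omega) (by omega)) hηζ,
      hdepG.mono (Set.Icc_subset_Icc (by omega) (by omega)) hηζ]
  have hdepF : DependsOn (wallPair d (a + 1)) (Set.Icc (a + 1) (a + d + 2)) :=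
    dependsOn_wallPair le_rfl (by omega)
  have hh0 : ∀ ζ, 0 ≤ h ζ := fun ζ => le_max_right _ _
  have hm0 : (0 : ℝ) ≤ m := Nat.cast_nonneg m
  have hCh : (((a + 2 * m + 2 + d) + (2 * m + 1 : ℕ) - (a - 2 * m)).toNat : ℝ) ≤ C := by
    rw [show ((a + 2 * m + 2 + d) + (2 * m + 1 : ℕ) - (a - 2 * m)).toNat = 6 * m + 3 + d by omega]
    push_cast
    linarith
  have hCF : (((a + d + 2) + (2 * m + 1 : ℕ) - (a + 1)).toNat : ℝ) ≤ C := by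
    rw [show ((a + d + 2) + (2 * m + 1 : ℕ) - (a + 1)).toNat = 2 * m + 2 + d by omega]
    push_cast
    linarith
  have hpair : ∀ ζ, h ζ - C * wallPair d (a + 1) ζ
      ≤ generator (block (2 * m + 1)) (wallPair d (a + 1)) ζ := fun ζ => by
    have h₁ := update_sub_le_generator hdepF (wallPair_nonneg d (a + 1)) hCF
      (x := a + 1 - (2 * m + 1 : ℕ) + 1) (by rw [Finset.mem_Icc]; omega) ζ
    have h₂ : h ζ ≤ wallPair d (a + 1) (update (2 * m + 1) (a + 1 - (2 * m + 1 : ℕ) + 1) ζ) :=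
      max_le (wallPair_succ_sub_deficit_le hm hd a ζ) (wallPair_nonneg _ _ _)
    linarith
  have key : mean P η h t ≤ Real.exp C * mean P η (wallPair d (a + 1)) (t + 1) := by
    refine le_exp_mul_of_deriv_ge (continuous_mean hη hdepF) (continuous_mean hη hdepH)
      (fun s hs => hasDerivAt_mean hη hdepF (by linarith))
      (fun s hs => hasDerivAt_mean hη hdepH (by linarith)) (fun s _ => ?_) (fun s _ => ?_)
      (mean_nonneg (wallPair_nonneg d (a + 1)) t)
    · have hi := (hη.integrable hdepF s.toNNReal).const_mul C
      have := integral_mono ((hη.integrable hdepH s.toNNReal).sub hi)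
        (hη.integrable (dependsOn_generator (n := 2 * m + 1) hdepF) s.toNNReal)
        fun ω => hpair (η s.toNNReal ω)
      rw [integral_sub' (hη.integrable hdepH s.toNNReal) hi, integral_const_mul] at this
      exact this
    · exact neg_mul_mean_le_mean_generator hη hdepH hh0 hCh s
  have hsplit : mean P η (wallPair (d + 1) a) t
      ≤ mean P η (deficit m (a + 1)) t + mean P η h t := by
    have := integral_mono (hη.integrable hdepP t.toNNReal)
      ((hη.integrable hdepG t.toNNReal).add (hη.integrable hdepH t.toNNReal))
      fun ω => by
        have := le_max_left
          (wallPair (d + 1) a (η t.toNNReal ω) - deficit m (a + 1) (η t.toNNReal ω)) 0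
        simp only [Pi.add_apply, hh]
        linarith
    rwa [integral_add' (hη.integrable hdepG t.toNNReal) (hη.integrable hdepH t.toNNReal)] at this
  linarith

/-- If the wall densities are nearly maximal around `a`, then pairs of walls are unlikely. -/
lemma mean_wallPair_le (hη : IsMajorityRuleProcess (2 * m + 1) η₀ P ℱ η) (hm : 1 ≤ m) {T c : ℝ}
    (hT : 0 ≤ T) (hc : ∀ t, T ≤ t → ∀ e, mean P η (wall e) t ≤ c) {C δ : ℝ} {d : ℕ} (hd : 1 ≤ d)
    (hC : 6 * m + 5 + d ≤ C) :
    ∀ {t : ℝ} {a : ℤ}, T ≤ t →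
      (∀ i < d, c - mean P η (wall (a + 1 + i)) (t + 1 + i) ≤ δ) →
        mean P η (wallPair d a) t ≤ d * Real.exp C ^ d * δ := by
  induction d, hd using Nat.le_induction with
  | base =>
    intro t a ht h
    have h₁ := mean_mono hη (dependsOn_wallPair (d := 1) (le_refl a) le_rfl)
      (dependsOn_deficit le_rfl le_rfl) (wallPair_one_le_deficit hm a) t
    have h₂ := mean_deficit_le_gap hη hT hc ht (C := C) (by push_cast at hC; linarith) (a + 1)
    have h₃ := mul_le_mul_of_nonneg_left (h 0 (by norm_num)) (Real.exp_pos C).le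
    simp only [Nat.cast_zero, add_zero] at h₃
    simp only [Nat.cast_one, one_mul, pow_one]
    linarith
  | succ d hd ih =>
    intro t a ht h
    push_cast at hC
    have hm0 : (0 : ℝ) ≤ m := Nat.cast_nonneg m
    have hd0 : (0 : ℝ) ≤ d := Nat.cast_nonneg d
    have h₁ := mean_wallPair_succ_le hη hm (C := C) (t := t) (by linarith) hd (by linarith) a
    have h₂ := mean_deficit_le_gap hη hT hc ht (C := C) (by linarith) (a + 1)
    have h0 := h 0 (by omega)
    simp only [Nat.cast_zero, add_zero] at h0
    have h₃ := mul_le_mul_of_nonneg_left h0 (Real.exp_pos C).le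
    have h₄ := ih (by linarith) (t := t + 1) (a := a + 1) (by linarith) fun i hi => by
      have := h (i + 1) (by omega)
      push_cast at this
      convert this using 3 <;> ring_nf
    have h₅ := mul_le_mul_of_nonneg_left h₄ (Real.exp_pos C).le
    have hδ : 0 ≤ δ := le_trans (sub_nonneg.2 (hc _ (by linarith) _)) h0
    have hpow : Real.exp C ≤ Real.exp C ^ (d + 1) :=
      le_self_pow₀ (Real.one_le_exp (by linarith)) (by omega)
    have h₆ := mul_le_mul_of_nonneg_right hpow hδ
    calc mean P η (wallPair (d + 1) a) t
        ≤ Real.exp C * δ + Real.exp C * (d * Real.exp C ^ d * δ) := by linarith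
      _ ≤ Real.exp C ^ (d + 1) * δ + Real.exp C * (d * Real.exp C ^ d * δ) := by linarith
      _ = (d + 1 : ℕ) * Real.exp C ^ (d + 1) * δ := by push_cast; ring

/-- If the density comes within `δ` of its eventual upper bound `c`, then a window of `D` sites
carries about `D * c` walls in expectation but hardly ever two of them. -/
lemma mul_le_one_add_of_gap_le (hη : IsMajorityRuleProcess (2 * m + 1) η₀ P ℱ η) (hm : 1 ≤ m)
    {T c : ℝ} (hT : 0 ≤ T) (hc : ∀ t, T ≤ t → ∀ e, mean P η (wall e) t ≤ c) {C δ : ℝ} {D : ℕ}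
    (hC : 6 * m + 5 + D ≤ C) {t : ℝ} {e : ℤ} (ht : T + 2 * D ≤ t)
    (hgap : c - mean P η (wall e) t ≤ δ) :
    D * c ≤ 1 + (D * Real.exp C ^ (2 * D)
      + D * (D * (D * Real.exp C ^ D * Real.exp C ^ (2 * D)))) * δ := by
  have hm0 : (0 : ℝ) ≤ m := Nat.cast_nonneg m
  have hD0 : (0 : ℝ) ≤ D := Nat.cast_nonneg D
  have hδ : 0 ≤ δ := le_trans (sub_nonneg.2 (hc t (by linarith) e)) hgap
  have hexp : 1 ≤ Real.exp C := Real.one_le_exp (by linarith)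
  have hexp0 : 0 ≤ Real.exp C := by linarith
  set δ' := Real.exp C ^ (2 * D) * δ with hδ'
  have hδ0 : 0 ≤ δ' := by positivity
  -- All the sites and times needed below lie in the backward light cone of `(t, e)`.
  have hcone : ∀ i k : ℕ, k ≤ D → i ≤ D →
      c - mean P η (wall (e + i)) (t - 2 * D + k) ≤ δ' := by
    intro i k hk hi
    have h := gap_le_pow_mul hη hm hT hc (C := C) (by linarith) (δ := δ) (2 * D - k)
      (t := t - 2 * D + k) (e := e) (y := e + i)
      (by have : (0 : ℝ) ≤ k := Nat.cast_nonneg k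
          linarith)
      (by rw [Nat.cast_sub (by omega)]; convert hgap using 3; push_cast; ring)
      (by rw [abs_le]; omega)
    refine h.trans (mul_le_mul_of_nonneg_right ?_ hδ)
    exact pow_le_pow_right₀ hexp (by omega)
  have hpairs : ∀ i j : ℕ, i < j → j < D →
      mean P η (wallPair (j - i) (e + i)) (t - 2 * D) ≤ D * Real.exp C ^ D * δ' := by
    intro i j hij hj
    have hle : ((j - i : ℕ) : ℝ) ≤ D := by exact_mod_cast (by omega : j - i ≤ D)
    have h := mean_wallPair_le hη hm hT hc (C := C) (δ := δ') (d := j - i) (by omega)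
      (by linarith) (t := t - 2 * D) (a := e + i) (by linarith) fun k hk => by
        have := hcone (i + 1 + k) (k + 1) (by omega) (by omega)
        push_cast at this
        convert this using 3 <;> ring_nf
    refine h.trans (mul_le_mul_of_nonneg_right ?_ hδ0)
    have := pow_le_pow_right₀ hexp (show j - i ≤ D by omega)
    gcongr
  have hi : ∀ y, Integrable (fun ω => wall y (η (t - 2 * D).toNNReal ω)) P := fun y =>
    hη.integrable (dependsOn_wall (le_refl y) le_rfl) _
  have hi₂ : ∀ i j : ℕ,
      Integrable (fun ω => wallPair (j - i) (e + i) (η (t - 2 * D).toNNReal ω)) P :=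
    fun i j => hη.integrable (dependsOn_wallPair le_rfl le_rfl) _
  have hsum : ∑ i ∈ Finset.range D, mean P η (wall (e + i)) (t - 2 * D)
      ≤ 1 + ∑ j ∈ Finset.range D, ∑ i ∈ Finset.range j,
        mean P η (wallPair (j - i) (e + i)) (t - 2 * D) := by
    have h₂ : Integrable (fun ω => ∑ j ∈ Finset.range D, ∑ i ∈ Finset.range j,
        wallPair (j - i) (e + i) (η (t - 2 * D).toNNReal ω)) P :=
      integrable_finsetSum _ fun j _ => integrable_finsetSum _ fun i _ => hi₂ i j
    have h := integral_mono
      (integrable_finsetSum (Finset.range D) fun (i : ℕ) _ => hi (e + (i : ℤ)))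
      ((integrable_const (1 : ℝ)).add h₂) fun ω => by
        have := sum_range_le_one_add_pairs
          (p := fun i : ℕ => wall (e + i) (η (t - 2 * D).toNNReal ω))
          (fun i => wall_eq_zero_or_one _ _) D
        refine this.trans (le_of_eq ?_)
        simp only [Pi.add_apply]
        congr 1
        refine Finset.sum_congr rfl fun j _ => Finset.sum_congr rfl fun i hij => ?_
        rw [Finset.mem_range] at hij
        unfold wallPair
        rw [show e + (i : ℤ) + ((j - i : ℕ) : ℤ) = e + j by omega]
    rw [integral_finsetSum _ fun (i : ℕ) _ => hi (e + (i : ℤ)),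
      integral_add' (integrable_const _) h₂,
      integral_finsetSum _ fun j _ => integrable_finsetSum _ fun i _ => hi₂ i j] at h
    simp_rw [fun j : ℕ => integral_finsetSum (μ := P) (Finset.range j) fun i _ => hi₂ i j] at h
    simpa [mean] using h
  have hleft : D * (c - δ') ≤ ∑ i ∈ Finset.range D, mean P η (wall (e + i)) (t - 2 * D) := by
    have h := Finset.card_nsmul_le_sum (Finset.range D)
      (fun i : ℕ => mean P η (wall (e + i)) (t - 2 * D)) (c - δ') fun i hi => by
        have := hcone i 0 (by omega) (Finset.mem_range.1 hi).le
        simp only [Nat.cast_zero, add_zero] at this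
        linarith
    simpa using h
  have hright : ∑ j ∈ Finset.range D, ∑ i ∈ Finset.range j,
      mean P η (wallPair (j - i) (e + i)) (t - 2 * D) ≤ D * (D * (D * Real.exp C ^ D * δ')) := by
    have h := Finset.sum_le_card_nsmul (Finset.range D)
      (fun j => ∑ i ∈ Finset.range j, mean P η (wallPair (j - i) (e + i)) (t - 2 * D))
      (D * (D * Real.exp C ^ D * δ')) fun j hj => by
        rw [Finset.mem_range] at hj
        have h := Finset.sum_le_card_nsmul (Finset.range j)
          (fun i => mean P η (wallPair (j - i) (e + i)) (t - 2 * D))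
          (D * Real.exp C ^ D * δ') fun i hij => hpairs i j (Finset.mem_range.1 hij) hj
        rw [Finset.card_range, nsmul_eq_mul] at h
        refine h.trans (mul_le_mul_of_nonneg_right ?_ (by positivity))
        exact_mod_cast hj.le
    simpa using h
  have : D * c ≤ 1 + (D * δ' + D * (D * (D * Real.exp C ^ D * δ'))) := by linarith
  refine this.trans (le_of_eq ?_)
  rw [hδ']
  ring

/-- The wall densities tend to zero, uniformly in space. -/
lemma eventually_mean_wall_le (hη : IsMajorityRuleProcess (2 * m + 1) η₀ P ℱ η) (hm : 1 ≤ m)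
    {ε : ℝ} (hε : 0 < ε) : ∃ T : ℝ, 0 ≤ T ∧ ∀ t, T ≤ t → ∀ e, mean P η (wall e) t ≤ ε := by
  obtain ⟨D, hD⟩ := exists_nat_gt (2 / ε)
  rw [div_lt_iff₀ hε] at hD
  set C : ℝ := 6 * m + 5 + D with hC
  set B : ℝ := D * Real.exp C ^ (2 * D)
      + D * (D * (D * Real.exp C ^ D * Real.exp C ^ (2 * D))) with hB
  have hB0 : 0 ≤ B := by positivity
  set δ : ℝ := 1 / (B + 1) with hδ
  have hδ0 : 0 < δ := by positivity
  have hBδ : B * δ < 1 := by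
    rw [hδ, mul_one_div, div_lt_one (by positivity)]
    linarith
  -- As long as the eventual bound is at least `ε`, it can be improved by `δ`.
  have hk : ∀ k : ℕ, ∃ T : ℝ, 0 ≤ T ∧
      ∀ t, T ≤ t → ∀ e, mean P η (wall e) t ≤ max ε (1 - k * δ) := by
    intro k
    induction k with
    | zero =>
      refine ⟨0, le_rfl, fun t _ e => ?_⟩
      have h := mean_mono hη (dependsOn_wall (le_refl e) le_rfl)
        ((dependsOn_const (1 : ℝ)).mono (Set.empty_subset (Set.Icc 0 0))) (wall_le_one e) t
      refine h.trans ?_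
      simp [mean]
    | succ k ih =>
      obtain ⟨T, hT, hc⟩ := ih
      refine ⟨T + 2 * D, by positivity, fun t ht e => ?_⟩
      by_contra hcon
      rw [not_le, max_lt_iff] at hcon
      obtain ⟨h₁, h₂⟩ := hcon
      push_cast at h₂
      have hgap : max ε (1 - k * δ) - mean P η (wall e) t ≤ δ := by
        rw [sub_le_iff_le_add]
        exact max_le (by linarith) (by linarith)
      have h := mul_le_one_add_of_gap_le hη hm hT hc hC.ge ht hgap
      have h₃ : D * ε ≤ D * max ε (1 - k * δ) :=
        mul_le_mul_of_nonneg_left (le_max_left _ _) (Nat.cast_nonneg D)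
      linarith
  obtain ⟨k, hk'⟩ := exists_nat_gt (1 / δ)
  rw [div_lt_iff₀ hδ0] at hk'
  obtain ⟨T, hT, h⟩ := hk k
  exact ⟨T, hT, fun t ht e => (h t ht e).trans (max_le le_rfl (by linarith))⟩

lemma measure_ne_succ_eq (hη : IsMajorityRuleProcess (2 * m + 1) η₀ P ℱ η) (e : ℤ) (t : ℝ≥0) :
    P {ω | η t ω e ≠ η t ω (e + 1)} = ENNReal.ofReal (mean P η (wall e) t) := by
  have hms : MeasurableSet {ω | η t ω e ≠ η t ω (e + 1)} :=
    (measurableSet_eq_fun ((measurable_pi_apply e).comp (hη.measurable t))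
      ((measurable_pi_apply (e + 1)).comp (hη.measurable t))).compl
  have h : mean P η (wall e) t = ∫ ω, Set.indicator {ω | η t ω e ≠ η t ω (e + 1)} 1 ω ∂P := by
    unfold mean
    rw [Real.toNNReal_coe]
    refine integral_congr_ae (Eventually.of_forall fun ω => ?_)
    simp [wall, Set.indicator_apply]
  rw [h, integral_indicator_one hms, ofReal_measureReal]

lemma tendsto_measure_ne_succ (hη : IsMajorityRuleProcess (2 * m + 1) η₀ P ℱ η) (hm : 1 ≤ m)
    (e : ℤ) : Tendsto (fun t => P {ω | η t ω e ≠ η t ω (e + 1)}) atTop (𝓝 0) := by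
  simp_rw [measure_ne_succ_eq hη]
  rw [← ENNReal.ofReal_zero]
  refine (ENNReal.continuous_ofReal.tendsto 0).comp ?_
  rw [Metric.tendsto_atTop]
  intro ε hε
  obtain ⟨T, hT, h⟩ := eventually_mean_wall_le hη hm (half_pos hε)
  refine ⟨⟨T, hT⟩, fun t ht => ?_⟩
  rw [Real.dist_0_eq_abs, abs_of_nonneg (mean_nonneg (wall_nonneg e) _)]
  have := h t ht e
  linarith

lemma tendsto_measure_ne_add (hη : IsMajorityRuleProcess (2 * m + 1) η₀ P ℱ η) (hm : 1 ≤ m)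
    (x : ℤ) (k : ℕ) : Tendsto (fun t => P {ω | η t ω x ≠ η t ω (x + k)}) atTop (𝓝 0) := by
  induction k with
  | zero => simp
  | succ k ih =>
    have h := ih.add (tendsto_measure_ne_succ hη hm (x + k))
    rw [add_zero] at h
    refine tendsto_of_tendsto_of_tendsto_of_le_of_le tendsto_const_nhds h (fun _ => zero_le) ?_
    intro t
    refine (measure_mono fun ω hω => ?_).trans (measure_union_le _ _)
    by_contra hcon
    simp only [Set.mem_union, Set.mem_ofPred_eq, not_or, not_not] at hcon
    refine hω ?_
    rw [hcon.1, hcon.2]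
    push_cast
    ring_nf

end Density

end MajorityRule

theorem mainTheorem2 (n : ℕ) (hn : 1 < n) (hodd : Odd n) (η₀ : MajorityRule.Config ℤ)
    {Ω : Type*} {mΩ : MeasurableSpace Ω} (P : Measure Ω) [IsProbabilityMeasure P]
    (ℱ : Filtration ℝ≥0 mΩ) (η : ℝ≥0 → Ω → MajorityRule.Config ℤ)
    (hη : MajorityRule.IsMajorityRuleProcess n η₀ P ℱ η) :
    MajorityRule.Clusters P η := by
  obtain ⟨m, rfl⟩ := hodd
  have hm : 1 ≤ m := by omega
  intro x y
  rcases le_total x y with h | h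
  · obtain ⟨k, rfl⟩ := Int.le.dest h
    exact MajorityRule.tendsto_measure_ne_add hη hm x k
  · obtain ⟨k, rfl⟩ := Int.le.dest h
    simp_rw [ne_comm (b := η _ _ y)]
    exact MajorityRule.tendsto_measure_ne_add hη hm y k
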